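/- A matroid $M$ on a finite set $E$ is \emph{regular} if it is the column matroid over $\mathbb{R}$ of a totally unimodular $r\times|E|$ integer matrix $A$ of rank $r$ (for some $r\ge 0$), with columns labelled by $E$; such an $A$ is called a totally unimodular representation of $M$. The lattice of integer cuts of $M$ (relative to $A$) is $\Gamma(M)=\mathrm{Row}(A)\cap\mathbb{Z}^E$, where $\mathrm{Row}(A)\subseteq\mathbb{R}^E$ is the real row space of $A$, equipped with the Euclidean dot product. Two lattices are \emph{isometric} if there is an isomorphism of abelian groups between them that preserves the bilinear forms. Let $M^\circ$ denote the matroid obtained from $M$ by deleting all loops. Let $M$ and $N$ be regular matroids. Then $\Gamma(M)$ and $\Gamma(N)$, formed with respect to any totally unimodular representations of $M$ and $N$, are isometric if and only if $M^\circ$ and $N^\circ$ are isomorphic. -/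

import Mathlib

open scoped Matroid

namespace RegularMatroid

universe u v

/-- `A` is a totally unimodular representation of the matroid `M` (on a finite ground set `M.E`):
an `r × |M.E|` totally unimodular integer matrix of rank `r`, with columns labelled by `M.E`, whose
column matroid over `ℝ` is `M`. -/
structure IsTURepresentation {α : Type u} (M : Matroid α) [Fintype M.E] {r : ℕ}
    (A : Matrix (Fin r) M.E ℤ) : Prop where
  totallyUnimodular : A.IsTotallyUnimodular
  rank_eq : (A.map (Int.cast : ℤ → ℝ)).rank = r
  indep_iff : ∀ I : Set M.E,
    M.Indep (Subtype.val '' I) ↔ LinearIndepOn ℝ (A.map (Int.cast : ℤ → ℝ)).col I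

/-- A matroid on a finite ground set is regular if it is the column matroid over `ℝ` of some
totally unimodular matrix of full row rank. -/
def IsRegular {α : Type u} (M : Matroid α) [Fintype M.E] : Prop :=
  ∃ (r : ℕ) (A : Matrix (Fin r) M.E ℤ), IsTURepresentation M A

/-- The lattice `Row(A) ∩ ℤ^E`, where `Row(A) ⊆ ℝ^E` is the real row space of `A`. When `A` is a
totally unimodular representation of a regular matroid `M`, this is the lattice of integer cuts
of `M` (relative to `A`). -/
def cutLattice {E : Type u} {r : ℕ} (A : Matrix (Fin r) E ℤ) : AddSubgroup (E → ℤ) where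
  carrier := {x | (fun e => (x e : ℝ)) ∈
    Submodule.span ℝ (Set.range (A.map (Int.cast : ℤ → ℝ)).row)}
  zero_mem' := by
    have h : (fun e : E => (((0 : E → ℤ) e : ℤ) : ℝ)) = 0 := by ext; simp
    rw [Set.mem_ofPred_eq, h]
    exact Submodule.zero_mem _
  add_mem' := by
    intro x y hx hy
    have h : (fun e : E => (((x + y) e : ℤ) : ℝ))
        = (fun e => (x e : ℝ)) + (fun e => (y e : ℝ)) := by ext; simp
    rw [Set.mem_ofPred_eq, h]
    exact Submodule.add_mem _ hx hy
  neg_mem' := by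
    intro x hx
    have h : (fun e : E => (((-x) e : ℤ) : ℝ)) = -(fun e => (x e : ℝ)) := by ext; simp
    rw [Set.mem_ofPred_eq, h]
    exact Submodule.neg_mem _ hx

/-- Two lattices of integer vectors are isometric if there is an isomorphism of abelian groups
between them that preserves the Euclidean dot product (its inverse then preserves it as well). -/
def Isometric {E : Type u} {F : Type v} [Fintype E] [Fintype F]
    (L : AddSubgroup (E → ℤ)) (L' : AddSubgroup (F → ℤ)) : Prop :=
  ∃ ψ : L ≃+ L', ∀ x y : L,
    ((ψ x : L') : F → ℤ) ⬝ᵥ ((ψ y : L') : F → ℤ) = (x : E → ℤ) ⬝ᵥ (y : E → ℤ)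

/-- Two matroids are isomorphic if some bijection between their ground sets preserves
independence in both directions. -/
def Isomorphic {α : Type u} {β : Type v} (M : Matroid α) (N : Matroid β) : Prop :=
  ∃ e : M.E ≃ N.E, ∀ I : Set M.E,
    M.Indep (Subtype.val '' I) ↔ N.Indep (Subtype.val '' (e '' I))

/-- The matroid `M°` obtained from `M` by deleting all loops. -/
def deleteLoops {α : Type u} (M : Matroid α) : Matroid α := M ＼ M.loops

end RegularMatroid

namespace RegularMatroid

open Matrix

/-! From isometry to isomorphism: write `Γ` for the cut lattice. For `x` in `Γ`, total unimodularity
lets `x / 2` be rounded to some `g` in `Γ`, so `x - 2g` has entries `0, ±1`. The least norm in `x +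
2Γ` is therefore the number of odd entries of `x` (`exists_card_odd_eq_dotProduct_self`), and an
isometry preserves Hamming weights modulo two. The MacWilliams extension theorem
(`exists_equiv_of_weight_eq`) turns this into a bijection between the coordinates that are nonzero
modulo two, which are the nonloops. Independence can be read off from `Γ` modulo two
(`linearIndepOn_col_iff`), so this bijection is a matroid isomorphism.

Conversely, take standard forms with respect to corresponding bases. Their entries are nonzero
exactly where a basis exchange is possible, so the two supports agree. Totally unimodular matrices
with equal support differ by row and column signs (`exists_signing`). Row signs only change the
lattice basis, and column signs preserve the dot product. -/

theorem mem_range_signCast_iff {x : ℤ} :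
    x ∈ Set.range (SignType.cast : SignType → ℤ) ↔ x = 0 ∨ x = 1 ∨ x = -1 := by
  constructor
  · rintro ⟨s, rfl⟩
    cases s <;> simp
  · rintro (rfl | rfl | rfl)
    exacts [⟨0, by simp⟩, ⟨1, by simp⟩, ⟨-1, by simp⟩]

/-! ### Uniqueness of totally unimodular signings -/

section Signing

variable {m n : Type*}

/-- The Schur complement of a totally unimodular matrix at a nonzero entry, padded with a zero row
and a zero column, is totally unimodular. -/
theorem isTotallyUnimodular_schur {A : Matrix m n ℤ} (hA : A.IsTotallyUnimodular) {k : m} {c : n}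
    (hkc : A k c ≠ 0) :
    (Matrix.of fun i j => A i j - A i c * A k c * A k j).IsTotallyUnimodular := by
  have hp : A k c = 1 ∨ A k c = -1 := by
    rcases mem_range_signCast_iff.1 (hA.apply k c) with h | h
    · exact absurd h hkc
    · exact h
  have hpp : A k c * A k c = 1 := by rcases hp with h | h <;> simp [h]
  rw [isTotallyUnimodular_iff]
  intro l f g
  -- Border the minor with the pivot row and column: the bordered determinant is the pivot times the
  -- Schur minor. The pivot is `±1`, hence its own inverse.
  have h := (isTotallyUnimodular_iff_fintype A).1 hA (Unit ⊕ Fin l)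
    (Sum.elim (fun _ => k) f) (Sum.elim (fun _ => c) g)
  let P : Matrix Unit Unit ℤ := Matrix.of fun _ _ => A k c
  have hPP : P * P = 1 := by
    ext i j
    simp [P, Matrix.mul_apply, hpp]
  let _ : Invertible P := ⟨P, hPP, hPP⟩
  have hb : A.submatrix (Sum.elim (fun _ => k) f) (Sum.elim (fun _ => c) g) =
      fromBlocks P (Matrix.of fun _ j => A k (g j)) (Matrix.of fun i _ => A (f i) c)
        (A.submatrix f g) := by
    ext (i | i) (j | j) <;> simp [P]
  have hS : A.submatrix f g - (Matrix.of fun i (_ : Unit) => A (f i) c) * ⅟P *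
      (Matrix.of fun (_ : Unit) j => A k (g j)) =
      (Matrix.of fun i j => A i j - A i c * A k c * A k j).submatrix f g := by
    ext i j
    have hinv : ⅟P = P := rfl
    rw [hinv]
    simp [Matrix.mul_apply, P]
  rw [hb, det_fromBlocks₁₁, hS] at h
  have hd : P.det = A k c := by simp [P]
  rw [hd, mem_range_signCast_iff] at h
  rw [mem_range_signCast_iff]
  generalize ((Matrix.of fun i j => A i j - A i c * A k c * A k j).submatrix f g).det = x at h ⊢
  rcases hp with hp | hp <;> rw [hp] at h <;> omega

/-- A walk of length `l` between rows, consecutive ones having a common nonzero column. -/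
def RowWalk (D : Matrix m n ℤ) : ℕ → m → m → Prop
  | 0, i, j => i = j
  | l + 1, i, j => ∃ c k, D i c ≠ 0 ∧ D k c ≠ 0 ∧ RowWalk D l k j

theorem RowWalk.snoc {D : Matrix m n ℤ} {l : ℕ} {i j k : m} {c : n} (h : RowWalk D l i j)
    (hj : D j c ≠ 0) (hk : D k c ≠ 0) : RowWalk D (l + 1) i k := by
  induction l generalizing i with
  | zero =>
    obtain rfl : i = j := h
    exact ⟨c, k, hj, hk, rfl⟩
  | succ l ih =>
    obtain ⟨c', k', h1, h2, h3⟩ := h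
    exact ⟨c', k', h1, h2, ih h3⟩

/-- A row walk either survives in the Schur complement, or meets the pivot column. -/
theorem RowWalk.schur {D : Matrix m n ℤ} (k : m) (c : n) {l : ℕ} {i j : m}
    (h : RowWalk D l i j) :
    RowWalk (Matrix.of fun i j => D i j - D i c * D k c * D k j) l i j ∨
      ∃ l' ≤ l, ∃ v, D v c ≠ 0 ∧ RowWalk D l' v j := by
  induction l generalizing i with
  | zero => exact Or.inl h
  | succ l ih =>
    by_cases hi : D i c = 0
    · obtain ⟨c', k', h1, h2, h3⟩ := h
      by_cases hk' : D k' c = 0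
      · rcases ih h3 with h4 | ⟨l', hl', h4⟩
        · exact Or.inl ⟨c', k', by simpa [hi] using h1, by simpa [hk'] using h2, h4⟩
        · exact Or.inr ⟨l', by omega, h4⟩
      · exact Or.inr ⟨l, by omega, k', hk', h3⟩
    · exact Or.inr ⟨l + 1, le_rfl, i, hi, h⟩

/-- Two columns that extend a matrix to totally unimodular matrices and agree up to signs cannot
agree in one row and be opposite in another one connected to it. -/
theorem false_of_rowWalk (l : ℕ) : ∀ (D : Matrix m n ℤ) (d d' : m → ℤ),
    (fromCols D (replicateCol Unit d)).IsTotallyUnimodular →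
    (fromCols D (replicateCol Unit d')).IsTotallyUnimodular →
    (∀ i, d i = 0 ↔ d' i = 0) →
    ∀ i j, d i ≠ 0 → d' i = d i → d j ≠ 0 → d' j = -d j → RowWalk D l i j → False := by
  induction l using Nat.strong_induction_on with
  | _ l ih =>
  intro D d d' hD hD' hsupp i j hi hi' hj hj' hw
  match l, hw with
  | 0, hw =>
    obtain rfl : i = j := hw
    omega
  | 1, hw =>
    -- The column `c` together with `d`, respectively `d'`, gives two 2×2 minors in rows `i` and
    -- `k`; one of them is `±2`.
    obtain ⟨c, k, h1, h2, h3⟩ := hw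
    obtain rfl : k = j := h3
    have t1 := (isTotallyUnimodular_iff _).1 hD 2 ![i, k] ![Sum.inl c, Sum.inr ()]
    have t2 := (isTotallyUnimodular_iff _).1 hD' 2 ![i, k] ![Sum.inl c, Sum.inr ()]
    have e1 := hD.apply i (Sum.inl c)
    have e2 := hD.apply k (Sum.inl c)
    have e3 := hD.apply i (Sum.inr ())
    have e4 := hD.apply k (Sum.inr ())
    simp only [mem_range_signCast_iff, det_fin_two, submatrix_apply, cons_val_zero, cons_val_one,
      fromCols_apply_inl, fromCols_apply_inr, replicateCol_apply, hi', hj'] at t1 t2 e1 e2 e3 e4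
    rcases e1 with e1 | e1 | e1 <;> rcases e2 with e2 | e2 | e2 <;>
      rcases e3 with e3 | e3 | e3 <;> rcases e4 with e4 | e4 | e4 <;>
      simp [e1, e2, e3, e4] at t1 t2 h1 h2 hi hj
  | l + 2, hw =>
    obtain ⟨c, k, h1, h2, h3⟩ := hw
    by_cases hk : d k = 0
    -- Without a shortcut, pivot on `(k, c)`. Since `d` and `d'` vanish at `k` they are unchanged,
    -- while the entry `(i, c₂)` becomes nonzero, so the walk can skip row `k`.
    · have shortcut : ∀ l' ≤ l, ∀ v, D v c ≠ 0 → RowWalk D l' v j → False := fun l' hl' v hv hw' =>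
        ih (l' + 1) (by omega) D d d' hD hD' hsupp i j hi hi' hj hj' ⟨c, v, h1, hv, hw'⟩
      obtain ⟨c₂, k₂, h4, h5, h6⟩ := h3
      by_cases hic : D i c₂ = 0
      · have schur : ∀ e : m → ℤ, e k = 0 →
            (fromCols D (replicateCol Unit e)).IsTotallyUnimodular →
            (fromCols (Matrix.of fun i j => D i j - D i c * D k c * D k j)
              (replicateCol Unit e)).IsTotallyUnimodular := by
          intro e he hDe
          convert isTotallyUnimodular_schur hDe (k := k) (c := Sum.inl c) (by simpa using h2)
            using 1
          ext x (y | y) <;> simp [he]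
        by_cases hk₂ : D k₂ c = 0
        · rcases h6.schur k c with h7 | ⟨l', hl', v, hv, h7⟩
          · refine ih (l + 1) (by omega) _ d d' (schur d hk hD) (schur d' ((hsupp k).1 hk) hD') hsupp
              i j hi hi' hj hj' ⟨c₂, k₂, ?_, ?_, h7⟩
            · simp [hic, h1, h2, h4]
            · simpa [hk₂] using h5
          · exact shortcut l' hl' v hv h7
        · exact shortcut l le_rfl k₂ hk₂ h6
      · exact ih (l + 1) (by omega) D d d' hD hD' hsupp i j hi hi' hj hj' ⟨c₂, k₂, hic, h5, h6⟩
    -- The sign comparison at `k` differs from that at `j` or from that at `i`; either way a shorter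
    -- walk joins two conflicting rows.
    · have hdk : d' k = d k ∨ d' k = -d k := by
        have t1 := mem_range_signCast_iff.1 (hD.apply k (Sum.inr ()))
        have t2 := mem_range_signCast_iff.1 (hD'.apply k (Sum.inr ()))
        have hk' := (hsupp k).not.1 hk
        simp only [fromCols_apply_inr, replicateCol_apply] at t1 t2
        omega
      rcases hdk with hdk | hdk
      · exact ih (l + 1) (by omega) D d d' hD hD' hsupp k j hk hdk hj hj' h3
      · exact ih 1 (by omega) D d d' hD hD' hsupp i k hi hi' hk hdk ⟨c, k, h1, h2, rfl⟩

theorem isTotallyUnimodular_units_mul {C : Matrix m n ℤ} (hC : C.IsTotallyUnimodular)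
    (ρ : m → ℤˣ) (σ : n → ℤˣ) :
    (Matrix.of fun i j => (ρ i : ℤ) * σ j * C i j).IsTotallyUnimodular := by
  rw [isTotallyUnimodular_iff] at hC ⊢
  intro k f g
  have h : (Matrix.of fun i j => (ρ i : ℤ) * σ j * C i j).submatrix f g =
      Matrix.of fun i j => (ρ (f i) : ℤ) *
        (Matrix.of fun i j => (σ (g j) : ℤ) * C.submatrix f g i j) i j := by
    ext i j
    simp [mul_assoc]
  rw [h, det_mul_column, det_mul_row]
  have hu : (∏ i, (ρ (f i) : ℤ)) * ∏ j, (σ (g j) : ℤ) =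
      (((∏ i, ρ (f i)) * ∏ j, σ (g j) : ℤˣ) : ℤ) := by push_cast; rfl
  have hd := mem_range_signCast_iff.1 (hC k f g)
  rw [← mul_assoc, hu, mem_range_signCast_iff]
  rcases Int.units_eq_one_or ((∏ i, ρ (f i)) * ∏ j, σ (g j)) with h1 | h1 <;> rw [h1] <;>
    simp only [Units.val_one, Units.val_neg] <;> omega

/-- Two totally unimodular matrices with the same support differ by signs of rows and columns. -/
theorem exists_signing [Finite n] {C C' : Matrix m n ℤ} (hC : C.IsTotallyUnimodular)
    (hC' : C'.IsTotallyUnimodular) (hsupp : ∀ i j, C i j = 0 ↔ C' i j = 0) :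
    ∃ (ρ : m → ℤˣ) (σ : n → ℤˣ), ∀ i j, C' i j = ρ i * σ j * C i j := by
  classical
  have key : ∀ S : Finset n, ∃ (ρ : m → ℤˣ) (σ : n → ℤˣ),
      ∀ i, ∀ j ∈ S, C' i j = ρ i * σ j * C i j := by
    intro S
    induction S using Finset.induction_on with
    | empty => exact ⟨1, 1, by simp⟩
    | insert e S he ih =>
      obtain ⟨ρ, σ, h⟩ := ih
      let D : Matrix m S ℤ := C'.submatrix id Subtype.val
      let d : m → ℤ := fun i => ρ i * C i e
      let d' : m → ℤ := fun i => C' i e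
      have hD : (fromCols D (replicateCol Unit d)).IsTotallyUnimodular := by
        convert (isTotallyUnimodular_units_mul hC ρ (Function.update σ e 1)).submatrix id
          (Sum.elim Subtype.val (fun _ => e) : S ⊕ Unit → n) using 1
        ext i (⟨j, hj⟩ | j)
        · have hje : j ≠ e := fun h => he (h ▸ hj)
          simp [D, h i j hj, hje]
        · simp [d]
      have hD' : (fromCols D (replicateCol Unit d')).IsTotallyUnimodular := by
        convert hC'.submatrix id (Sum.elim Subtype.val (fun _ => e) : S ⊕ Unit → n) using 1
        ext i (j | j) <;> simp [D, d']
      have hdd : ∀ i, d i = 0 ↔ d' i = 0 := by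
        intro i
        simp [d, d', hsupp i e]
      -- The components of rows containing a wrong sign in the new column. Flipping these rows, and
      -- the old columns meeting them, keeps the old columns correct.
      let T : Set m := {i | ∃ j l, d j ≠ 0 ∧ d' j = -d j ∧ RowWalk D l j i}
      have hT : ∀ c ∈ S, ∀ i k, C i c ≠ 0 → C k c ≠ 0 → i ∈ T → k ∈ T := by
        rintro c hc i k hi hk ⟨j, l, hj, hj', hw⟩
        refine ⟨j, l + 1, hj, hj', hw.snoc (c := ⟨c, hc⟩) ?_ ?_⟩
        · exact (hsupp i c).not.1 hi
        · exact (hsupp k c).not.1 hk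
      refine ⟨fun i => if i ∈ T then -ρ i else ρ i,
        fun c => if c = e then 1 else if ∃ i ∈ T, C i c ≠ 0 then -σ c else σ c, ?_⟩
      intro i c hc
      by_cases h0 : C i c = 0
      · rw [h0, mul_zero, ← hsupp, h0]
      rcases Finset.mem_insert.1 hc with rfl | hc
      · have hdi : d i ≠ 0 := by simpa [d] using h0
        simp only [if_true, Units.val_one, mul_one]
        have hpm : d' i = d i ∨ d' i = -d i := by
          have t1 := mem_range_signCast_iff.1 (hD.apply i (Sum.inr ()))
          have t2 := mem_range_signCast_iff.1 (hD'.apply i (Sum.inr ()))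
          have hk' := (hdd i).not.1 hdi
          simp only [fromCols_apply_inr, replicateCol_apply] at t1 t2
          omega
        by_cases hi : i ∈ T
        · rw [if_pos hi]
          rcases hpm with hpm | hpm
          · obtain ⟨j, l, hj, hj', hw⟩ := hi
            -- A correct sign inside `T` would be connected to a wrong one; negating `d` puts the
            -- agreement at `j` and the conflict at `i`.
            refine (false_of_rowWalk l D (-d) d' ?_ hD' (by simpa using hdd) j i (by simpa using hj)
              (by simpa using hj') (by simpa using hdi) (by simpa using hpm) hw).elim
            convert isTotallyUnimodular_units_mul hD 1 (Sum.elim 1 (-1)) using 1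
            ext i (j | j) <;> simp
          · simpa [d, d'] using hpm
        · rw [if_neg hi]
          rcases hpm with hpm | hpm
          · simpa [d, d'] using hpm
          · exact absurd ⟨i, 0, hdi, hpm, rfl⟩ hi
      · have hce : c ≠ e := fun h => he (h ▸ hc)
        simp only [if_neg hce]
        rw [h i c hc]
        by_cases hi : i ∈ T
        · rw [if_pos hi, if_pos ⟨i, hi, h0⟩]
          simp
        · rw [if_neg hi, if_neg]
          rintro ⟨k, hk, hkc⟩
          exact hi (hT c hc k i hkc h0 hk)
  cases nonempty_fintype n
  obtain ⟨ρ, σ, h⟩ := key Finset.univ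
  exact ⟨ρ, σ, fun i j => h i j (Finset.mem_univ j)⟩

/-- A matrix that contains an identity matrix and whose maximal minors are `0` or `±1` is totally
unimodular. -/
theorem isTotallyUnimodular_of_maximal_minors [Fintype m] [DecidableEq m] {C : Matrix m n ℤ}
    {b : m → n} (hb : C.submatrix id b = 1)
    (h : ∀ g : m → n, (C.submatrix id g).det ∈ Set.range (SignType.cast : SignType → ℤ)) :
    C.IsTotallyUnimodular := by
  classical
  intro k f g hf _
  let e : Fin k ≃ Set.range f := Equiv.ofInjective f hf
  -- Rows outside the minor receive their identity columns, so the enlarged matrix is block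
  -- triangular with the same determinant up to reindexing.
  let g' : m → n := fun i => if hi : i ∈ Set.range f then g (e.symm ⟨i, hi⟩) else b i
  have hbij : ∀ i j, C i (b j) = (1 : Matrix m m ℤ) i j := fun i j => congrFun (congrFun hb i) j
  have hdet := h g'
  rw [twoBlockTriangular_det' _ (fun i => i ∈ Set.range f)] at hdet
  · have h1 : toSquareBlockProp (C.submatrix id g') (fun i => ¬ i ∈ Set.range f) = 1 := by
      ext ⟨i, hi⟩ ⟨j, hj⟩
      simp only [toSquareBlockProp_def, of_apply, submatrix_apply, id, g', dif_neg hj, hbij,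
        one_apply, Subtype.mk.injEq]
    have h2 : (C.submatrix f g) =
        (toSquareBlockProp (C.submatrix id g') (fun i => i ∈ Set.range f)).submatrix e e := by
      ext i j
      have hj : f j ∈ Set.range f := ⟨j, rfl⟩
      have hej : e.symm ⟨f j, hj⟩ = j := e.symm_apply_apply j
      simp [toSquareBlockProp_def, g', e]
    rw [h1, det_one, mul_one] at hdet
    rw [h2, det_submatrix_equiv_self]
    convert hdet
  · intro i hi j hj
    have hij : i ≠ j := fun h => hj (h ▸ hi)
    simp only [submatrix_apply, id, g', dif_neg hj, hbij, one_apply, if_neg hij]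

end Signing

/-! ### Column bases and standard forms -/

section Basis

variable {E : Type*} {r : ℕ} {A : Matrix (Fin r) E ℤ}

/-- The columns `b` of `A` form a basis of `ℝ ^ r`. -/
def IsColumnBasis (A : Matrix (Fin r) E ℤ) (b : Fin r → E) : Prop :=
  LinearIndependent ℝ fun i => (A.map (Int.cast : ℤ → ℝ)).col (b i)

theorem isColumnBasis_iff_det_ne_zero {b : Fin r → E} :
    IsColumnBasis A b ↔ (A.submatrix id b).det ≠ 0 := by
  have h1 : IsColumnBasis A b ↔ LinearIndependent ℝ
      ((A.submatrix id b).map (Int.cast : ℤ → ℝ)).col := Iff.rfl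
  rw [h1, linearIndependent_cols_iff_isUnit, isUnit_iff_isUnit_det, isUnit_iff_ne_zero]
  have h2 : ((A.submatrix id b).map (Int.cast : ℤ → ℝ)).det = ((A.submatrix id b).det : ℝ) :=
    (Int.castRingHom ℝ).map_det _ |>.symm
  rw [h2, Int.cast_ne_zero]

theorem IsColumnBasis.isUnit_det (hA : A.IsTotallyUnimodular) {b : Fin r → E}
    (hb : IsColumnBasis A b) : IsUnit (A.submatrix id b).det := by
  have h := (isTotallyUnimodular_iff A).1 hA r id b
  rw [isColumnBasis_iff_det_ne_zero] at hb
  rw [Int.isUnit_iff]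
  exact (mem_range_signCast_iff.1 h).resolve_left hb

theorem isColumnBasis_iff_linearIndepOn {b : Fin r → E} :
    IsColumnBasis A b ↔ b.Injective ∧
      LinearIndepOn ℝ (A.map (Int.cast : ℤ → ℝ)).col (Set.range b) := by
  constructor
  · intro h
    have hi : b.Injective := fun i j hij => h.injective (by simp only [hij])
    exact ⟨hi, (linearIndepOn_range_iff hi _).2 h⟩
  · rintro ⟨hi, h⟩
    exact (linearIndepOn_range_iff hi _).1 h

theorem exists_isColumnBasis_between [Fintype E] {I T : Set E} (hIT : I ⊆ T)
    (hI : LinearIndepOn ℝ (A.map (Int.cast : ℤ → ℝ)).col I)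
    (hT : Submodule.span ℝ ((A.map (Int.cast : ℤ → ℝ)).col '' T) = ⊤) :
    ∃ b : Fin r → E, IsColumnBasis A b ∧ I ⊆ Set.range b ∧ Set.range b ⊆ T := by
  classical
  obtain ⟨J, hJT, hIJ, hspan, hJ⟩ := exists_linearIndepOn_extension hI hIT
  have hcard : Fintype.card J = r := by
    have h1 : Module.finrank ℝ (Submodule.span ℝ
        (Set.range fun j : J => (A.map (Int.cast : ℤ → ℝ)).col j)) = Fintype.card J :=
      finrank_span_eq_card hJ
    have h2 : Submodule.span ℝ (Set.range fun j : J => (A.map (Int.cast : ℤ → ℝ)).col j) = ⊤ := by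
      rw [← Set.image_eq_range, eq_top_iff, ← hT, Submodule.span_le]
      exact hspan
    rw [← h1, h2, finrank_top, Module.finrank_fin_fun]
  let e : Fin r ≃ J := (Fintype.equivFinOfCardEq hcard).symm
  refine ⟨fun i => e i, LinearIndependent.comp hJ e e.injective, ?_, ?_⟩
  · intro x hx
    exact ⟨e.symm ⟨x, hIJ hx⟩, by simp⟩
  · rintro _ ⟨i, rfl⟩
    exact hJT (e i).2

theorem span_range_col_eq_top [Fintype E] (hr : (A.map (Int.cast : ℤ → ℝ)).rank = r) :
    Submodule.span ℝ (Set.range (A.map (Int.cast : ℤ → ℝ)).col) = ⊤ := by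
  apply Submodule.eq_top_of_finrank_eq
  rw [← rank_eq_finrank_span_cols, Module.finrank_fin_fun, hr]

theorem exists_isColumnBasis_superset [Fintype E] (hr : (A.map (Int.cast : ℤ → ℝ)).rank = r)
    {I : Set E} (hI : LinearIndepOn ℝ (A.map (Int.cast : ℤ → ℝ)).col I) :
    ∃ b : Fin r → E, IsColumnBasis A b ∧ I ⊆ Set.range b := by
  obtain ⟨b, hb, hIb, -⟩ := exists_isColumnBasis_between (Set.subset_univ I) hI
    (by rw [Set.image_univ, span_range_col_eq_top hr])
  exact ⟨b, hb, hIb⟩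

theorem exists_isColumnBasis [Fintype E] (hr : (A.map (Int.cast : ℤ → ℝ)).rank = r) :
    ∃ b : Fin r → E, IsColumnBasis A b := by
  obtain ⟨b, hb, -⟩ := exists_isColumnBasis_superset hr (I := ∅) (by simp)
  exact ⟨b, hb⟩

theorem mem_cutLattice_iff_vecMul {x : E → ℤ} :
    x ∈ cutLattice A ↔
      ∃ y : Fin r → ℝ, ∀ e, (x e : ℝ) = (y ᵥ* A.map (Int.cast : ℤ → ℝ)) e := by
  change (fun e => (x e : ℝ)) ∈ Submodule.span ℝ (Set.range (A.map (Int.cast : ℤ → ℝ)).row) ↔ _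
  rw [Submodule.mem_span_range_iff_exists_fun]
  refine exists_congr fun y => ?_
  rw [funext_iff]
  refine forall_congr' fun e => ?_
  rw [eq_comm]
  simp [vecMul, dotProduct]

/-- The coordinates `y` of a vector of the real row space are integers as soon as the vector is
integral on a column basis. -/
theorem IsColumnBasis.exists_int (hA : A.IsTotallyUnimodular) {b : Fin r → E}
    (hb : IsColumnBasis A b) {y : Fin r → ℝ} {z : Fin r → ℤ}
    (hz : ∀ i, (y ᵥ* A.map (Int.cast : ℤ → ℝ)) (b i) = z i) :
    ∃ w : Fin r → ℤ, ∀ i, y i = w i := by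
  have hu := hb.isUnit_det hA
  refine ⟨z ᵥ* (A.submatrix id b)⁻¹, ?_⟩
  have h1 : y ᵥ* (A.submatrix id b).map (Int.cast : ℤ → ℝ) = fun i => (z i : ℝ) := by
    funext i
    rw [← hz i]
    rfl
  have h2 : (A.submatrix id b).map (Int.cast : ℤ → ℝ) *
      ((A.submatrix id b)⁻¹).map (Int.cast : ℤ → ℝ) = 1 := by
    have := congrArg (fun M => M.map (Int.castRingHom ℝ)) (mul_nonsing_inv _ hu)
    rw [Matrix.map_mul, Matrix.map_one _ (map_zero _) (map_one _)] at this
    exact this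
  have h3 : y = (fun i => (z i : ℝ)) ᵥ* ((A.submatrix id b)⁻¹).map (Int.cast : ℤ → ℝ) := by
    rw [← h1, vecMul_vecMul, h2, vecMul_one]
  intro i
  rw [congrFun h3 i]
  simp [vecMul, dotProduct]

/-- The matrix `A_b⁻¹ A`, which spans the same lattice as `A` and is an identity on `b`. -/
noncomputable def standardForm (A : Matrix (Fin r) E ℤ) (b : Fin r → E) : Matrix (Fin r) E ℤ :=
  (A.submatrix id b)⁻¹ * A

theorem submatrix_mul_standardForm (hA : A.IsTotallyUnimodular) {b : Fin r → E}
    (hb : IsColumnBasis A b) : A.submatrix id b * standardForm A b = A := by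
  rw [standardForm, ← Matrix.mul_assoc, mul_nonsing_inv _ (hb.isUnit_det hA), Matrix.one_mul]

theorem standardForm_submatrix (hA : A.IsTotallyUnimodular) {b : Fin r → E}
    (hb : IsColumnBasis A b) : (standardForm A b).submatrix id b = 1 := by
  rw [standardForm, submatrix_mul _ _ id id b Function.bijective_id, submatrix_id_id,
    nonsing_inv_mul _ (hb.isUnit_det hA)]

theorem det_standardForm_submatrix (hA : A.IsTotallyUnimodular) {b : Fin r → E}
    (hb : IsColumnBasis A b) (g : Fin r → E) :
    (A.submatrix id b).det * ((standardForm A b).submatrix id g).det =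
      (A.submatrix id g).det := by
  rw [← det_mul]
  conv_rhs => rw [← submatrix_mul_standardForm hA hb,
    submatrix_mul _ _ id id g Function.bijective_id, submatrix_id_id]

theorem isTotallyUnimodular_standardForm (hA : A.IsTotallyUnimodular) {b : Fin r → E}
    (hb : IsColumnBasis A b) : (standardForm A b).IsTotallyUnimodular := by
  refine isTotallyUnimodular_of_maximal_minors (standardForm_submatrix hA hb) fun g => ?_
  have h1 := det_standardForm_submatrix hA hb g
  have h2 := (isTotallyUnimodular_iff A).1 hA r id g
  rw [mem_range_signCast_iff] at h2 ⊢
  rcases Int.isUnit_iff.1 (hb.isUnit_det hA) with h | h <;> rw [h] at h1 <;> omega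

theorem vecMul_standardForm_mem (b : Fin r → E) (y : Fin r → ℤ) :
    y ᵥ* standardForm A b ∈ cutLattice A := by
  rw [mem_cutLattice_iff_vecMul]
  refine ⟨fun i => ((y ᵥ* (A.submatrix id b)⁻¹) i : ℝ), fun e => ?_⟩
  rw [standardForm, ← vecMul_vecMul]
  simp [vecMul, dotProduct]

theorem vecMul_standardForm_apply (hA : A.IsTotallyUnimodular) {b : Fin r → E}
    (hb : IsColumnBasis A b) (y : Fin r → ℤ) (i : Fin r) : (y ᵥ* standardForm A b) (b i) = y i := by
  have h := congrArg (fun M => (y ᵥ* M) i) (standardForm_submatrix hA hb)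
  rw [vecMul_one] at h
  exact h

/-- The basis minor is a unit, so an integer vector of the real row space is already an integer
combination of the rows of `A`. -/
theorem eq_vecMul_standardForm (hA : A.IsTotallyUnimodular) {b : Fin r → E}
    (hb : IsColumnBasis A b) {x : E → ℤ} (hx : x ∈ cutLattice A) :
    (fun i => x (b i)) ᵥ* standardForm A b = x := by
  obtain ⟨y, hy⟩ := mem_cutLattice_iff_vecMul.1 hx
  obtain ⟨w, hw⟩ := hb.exists_int hA (z := fun i => x (b i)) fun i => (hy (b i)).symm
  have h1 : x = w ᵥ* A := by
    funext e
    have := hy e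
    rw [funext hw] at this
    simp only [vecMul, dotProduct, map_apply] at this ⊢
    exact_mod_cast this
  have h2 : (fun i => x (b i)) = w ᵥ* A.submatrix id b := by
    rw [h1]
    rfl
  rw [h2, vecMul_vecMul, submatrix_mul_standardForm hA hb, h1]

/-- A vector of the cut lattice is given by its entries on a column basis. -/
noncomputable def cutLatticeEquiv (hA : A.IsTotallyUnimodular) {b : Fin r → E}
    (hb : IsColumnBasis A b) : cutLattice A ≃+ (Fin r → ℤ) where
  toFun x i := (x : E → ℤ) (b i)
  invFun y := ⟨y ᵥ* standardForm A b, vecMul_standardForm_mem b y⟩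
  left_inv x := Subtype.ext (eq_vecMul_standardForm hA hb x.2)
  right_inv y := funext fun i => vecMul_standardForm_apply hA hb y i
  map_add' _ _ := rfl

end Basis

/-! ### Rounding, and the lattice modulo two -/

section Rounding

variable {E : Type*} [Fintype E] {r : ℕ} {A : Matrix (Fin r) E ℤ}

/-- A nonzero functional kills the proper span of the columns in `T`, but not all columns, since
these span the whole space. -/
theorem exists_vecMul_eq_zero_on (hr : (A.map (Int.cast : ℤ → ℝ)).rank = r) {T : Set E}
    (hT : Submodule.span ℝ ((A.map (Int.cast : ℤ → ℝ)).col '' T) ≠ ⊤) :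
    ∃ w : Fin r → ℝ, (∀ e ∈ T, (w ᵥ* A.map (Int.cast : ℤ → ℝ)) e = 0) ∧
      ∃ e, (w ᵥ* A.map (Int.cast : ℤ → ℝ)) e ≠ 0 := by
  obtain ⟨f, hf, hTf⟩ := Submodule.exists_le_ker_of_lt_top _ (lt_top_iff_ne_top.2 hT)
  have key : ∀ e, ((fun i => f (Pi.single i 1)) ᵥ* A.map (Int.cast : ℤ → ℝ)) e =
      f ((A.map (Int.cast : ℤ → ℝ)).col e) := by
    intro e
    rw [LinearMap.pi_apply_eq_sum_univ f]
    simp only [vecMul, dotProduct, smul_eq_mul, col_apply, mul_comm]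
    refine Finset.sum_congr rfl fun i _ => ?_
    congr 2
    ext j
    simp [Pi.single_apply, eq_comm]
  refine ⟨fun i => f (Pi.single i 1), fun e he => ?_, ?_⟩
  · rw [key]
    exact hTf (Submodule.subset_span ⟨e, he, rfl⟩)
  · by_contra! h
    apply hf
    refine LinearMap.ext_on (span_range_col_eq_top hr) ?_
    rintro _ ⟨e, rfl⟩
    rw [← key, h, LinearMap.zero_apply]

/-- A vector of the real row space of a totally unimodular matrix can be rounded, each entry up or
down, to a vector of the cut lattice. -/
theorem exists_mem_cutLattice_floor_le_le_ceil (hA : A.IsTotallyUnimodular)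
    (hr : (A.map (Int.cast : ℤ → ℝ)).rank = r) (y : Fin r → ℝ) :
    ∃ z ∈ cutLattice A, ∀ e, ⌊(y ᵥ* A.map (Int.cast : ℤ → ℝ)) e⌋ ≤ z e ∧
      z e ≤ ⌈(y ᵥ* A.map (Int.cast : ℤ → ℝ)) e⌉ := by
  classical
  induction hN : (Finset.univ.filter fun e =>
    ¬ ∃ k : ℤ, (y ᵥ* A.map (Int.cast : ℤ → ℝ)) e = k).card using Nat.strong_induction_on
    generalizing y with
  | _ N ih =>
  set T : Set E := {e | ∃ k : ℤ, (y ᵥ* A.map (Int.cast : ℤ → ℝ)) e = k} with hTdef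
  by_cases hT : Submodule.span ℝ ((A.map (Int.cast : ℤ → ℝ)).col '' T) = ⊤
  · obtain ⟨b, hb, -, hbT⟩ := exists_isColumnBasis_between (Set.empty_subset T)
      (linearIndepOn_empty _ _) hT
    choose z hz using fun i => hbT ⟨i, rfl⟩
    obtain ⟨w, hw⟩ := hb.exists_int hA hz
    have h : ∀ e, (y ᵥ* A.map (Int.cast : ℤ → ℝ)) e = ((w ᵥ* A) e : ℤ) := by
      intro e
      rw [funext hw]
      simp [vecMul, dotProduct]
    refine ⟨w ᵥ* A, mem_cutLattice_iff_vecMul.2 ⟨y, fun e => (h e).symm⟩, fun e => ?_⟩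
    rw [h e]
    simp
  · obtain ⟨w, hwT, e₁, he₁⟩ := exists_vecMul_eq_zero_on hr hT
    set x := y ᵥ* A.map (Int.cast : ℤ → ℝ) with hx
    set v := w ᵥ* A.map (Int.cast : ℤ → ℝ) with hv
    -- The time at which coordinate `e`, moving with velocity `v e`, reaches its ceiling or floor.
    -- Stopping at the first such time keeps all bounds, fixes the integral coordinates and makes a
    -- new one integral.
    let s : E → ℝ := fun e => if 0 < v e then (⌈x e⌉ - x e) / v e else (⌊x e⌋ - x e) / v e
    obtain ⟨e₀, he₀, hmin⟩ := (Finset.univ.filter fun e => v e ≠ 0).exists_min_image s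
      ⟨e₁, by simpa using he₁⟩
    replace he₀ : v e₀ ≠ 0 := by simpa using he₀
    have hs : ∀ e, 0 ≤ s e := by
      intro e
      by_cases h : 0 < v e
      · simp only [s, if_pos h]
        exact div_nonneg (sub_nonneg.2 (Int.le_ceil _)) h.le
      · simp only [s, if_neg h]
        exact div_nonneg_of_nonpos (sub_nonpos.2 (Int.floor_le _)) (not_lt.1 h)
    have hx' : (y + s e₀ • w) ᵥ* A.map (Int.cast : ℤ → ℝ) = x + s e₀ • v := by
      rw [add_vecMul, smul_vecMul]
    have hbound : ∀ e, (⌊x e⌋ : ℝ) ≤ (x + s e₀ • v) e ∧ (x + s e₀ • v) e ≤ ⌈x e⌉ := by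
      intro e
      simp only [Pi.add_apply, Pi.smul_apply, smul_eq_mul]
      have h1 := Int.le_ceil (x e)
      have h2 := Int.floor_le (x e)
      rcases lt_trichotomy (v e) 0 with h | h | h
      · have h3 : s e₀ ≤ (⌊x e⌋ - x e) / v e := by
          simpa [s, h.not_gt] using hmin e (by simpa using h.ne)
        rw [le_div_iff_of_neg h] at h3
        have h4 := mul_nonpos_of_nonneg_of_nonpos (hs e₀) h.le
        constructor <;> linarith
      · rw [h, mul_zero, add_zero]
        exact ⟨h2, h1⟩
      · have h3 : s e₀ ≤ (⌈x e⌉ - x e) / v e := by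
          simpa [s, h] using hmin e (by simpa using h.ne')
        rw [le_div_iff₀ h] at h3
        have h4 := mul_nonneg (hs e₀) h.le
        constructor <;> linarith
    have hint : ∃ k : ℤ, (x + s e₀ • v) e₀ = k := by
      simp only [Pi.add_apply, Pi.smul_apply, smul_eq_mul]
      by_cases h : 0 < v e₀
      · exact ⟨⌈x e₀⌉, by simp only [s, if_pos h]; field_simp; ring⟩
      · exact ⟨⌊x e₀⌋, by simp only [s, if_neg h]; field_simp; ring⟩
    have hcard : (Finset.univ.filter fun e => ¬ ∃ k : ℤ, (x + s e₀ • v) e = k).card < N := by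
      rw [← hN]
      refine Finset.card_lt_card ⟨fun e he => ?_, fun hsub => ?_⟩
      · simp only [Finset.mem_filter, Finset.mem_univ, true_and] at he ⊢
        intro hk
        have := hwT e hk
        apply he
        simpa [this] using hk
      · have := hsub (x := e₀) (by
          simp only [Finset.mem_filter, Finset.mem_univ, true_and]
          exact fun hk => he₀ (hwT e₀ hk))
        simp only [Finset.mem_filter, Finset.mem_univ, true_and] at this
        exact this hint
    obtain ⟨z, hz, hz'⟩ := ih _ hcard (y + s e₀ • w) (by rw [hx'])
    rw [hx'] at hz'
    refine ⟨z, hz, fun e => ⟨?_, ?_⟩⟩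
    · exact (Int.le_floor.2 (hbound e).1).trans (hz' e).1
    · exact (hz' e).2.trans (Int.ceil_le.2 (hbound e).2)

theorem card_odd_le_dotProduct_self (x : E → ℤ) :
    ((Finset.univ.filter fun e => (x e : ZMod 2) ≠ 0).card : ℤ) ≤ x ⬝ᵥ x := by
  rw [Finset.card_filter, Nat.cast_sum]
  refine Finset.sum_le_sum fun e _ => ?_
  split_ifs with h
  · have : x e ≠ 0 := fun h0 => h (by simp [h0])
    have := mul_self_pos.2 this
    push_cast
    linarith
  · simpa using mul_self_nonneg (x e)

/-- The number of odd entries of `x` is the least norm in the coset `x + 2 Γ`. -/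
theorem exists_card_odd_eq_dotProduct_self (hA : A.IsTotallyUnimodular)
    (hr : (A.map (Int.cast : ℤ → ℝ)).rank = r) (x : cutLattice A) :
    ∃ g : cutLattice A, ((Finset.univ.filter fun e => ((x : E → ℤ) e : ZMod 2) ≠ 0).card : ℤ) =
      ((x - (g + g) : cutLattice A) : E → ℤ) ⬝ᵥ ((x - (g + g) : cutLattice A) : E → ℤ) := by
  obtain ⟨y, hy⟩ := mem_cutLattice_iff_vecMul.1 x.2
  -- Rounding `x / 2` to `g` leaves each entry of `x - 2g` strictly between `-2` and `2`.
  obtain ⟨g, hg, hgy⟩ := exists_mem_cutLattice_floor_le_le_ceil hA hr ((1 / 2 : ℝ) • y)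
  refine ⟨⟨g, hg⟩, ?_⟩
  rw [Finset.card_filter, Nat.cast_sum]
  refine Finset.sum_congr rfl fun e _ => ?_
  have h1 : (x : E → ℤ) e - (g e + g e) = 0 ∨ (x : E → ℤ) e - (g e + g e) = 1 ∨
      (x : E → ℤ) e - (g e + g e) = -1 := by
    obtain ⟨h1, h2⟩ := hgy e
    rw [smul_vecMul, Pi.smul_apply, ← hy e, smul_eq_mul] at h1 h2
    have h3 := Int.lt_floor_add_one (1 / 2 * ((x : E → ℤ) e : ℝ))
    have h4 := Int.ceil_lt_add_one (1 / 2 * ((x : E → ℤ) e : ℝ))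
    have h1' : (⌊1 / 2 * ((x : E → ℤ) e : ℝ)⌋ : ℝ) ≤ g e := by exact_mod_cast h1
    have h2' : (g e : ℝ) ≤ ⌈1 / 2 * ((x : E → ℤ) e : ℝ)⌉ := by exact_mod_cast h2
    have h5 : ((x : E → ℤ) e : ℝ) - (g e + g e) < 2 := by linarith
    have h6 : -2 < ((x : E → ℤ) e : ℝ) - (g e + g e) := by linarith
    have h5' : (x : E → ℤ) e - (g e + g e) < 2 := by exact_mod_cast h5
    have h6' : -2 < (x : E → ℤ) e - (g e + g e) := by exact_mod_cast h6
    omega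
  have h2 : ((x - (⟨g, hg⟩ + ⟨g, hg⟩) : cutLattice A) : E → ℤ) e = (x : E → ℤ) e - (g e + g e) :=
    rfl
  have h3 : (((x : E → ℤ) e : ℤ) : ZMod 2) = (((x : E → ℤ) e - (g e + g e) : ℤ) : ZMod 2) := by
    push_cast
    rw [CharTwo.add_self_eq_zero, sub_zero]
  rw [h2, h3]
  rcases h1 with h | h | h <;> rw [h] <;> simp

/-- Linear independence of columns is a property of the cut lattice modulo two. -/
theorem linearIndepOn_col_iff (hA : A.IsTotallyUnimodular)
    (hr : (A.map (Int.cast : ℤ → ℝ)).rank = r) (I : Set E) :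
    LinearIndepOn ℝ (A.map (Int.cast : ℤ → ℝ)).col I ↔
      ∀ t : E → ZMod 2, ∃ g : cutLattice A, ∀ i ∈ I, ((g : E → ℤ) i : ZMod 2) = t i := by
  classical
  constructor
  · intro hI t
    obtain ⟨b, hb, hIb⟩ := exists_isColumnBasis_superset hr hI
    refine ⟨⟨_, vecMul_standardForm_mem b fun i => ((t (b i)).val : ℤ)⟩, fun e he => ?_⟩
    obtain ⟨i, rfl⟩ := hIb he
    change (((_ ᵥ* standardForm A b) (b i) : ℤ) : ZMod 2) = _
    rw [vecMul_standardForm_apply hA hb]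
    simp
  · intro h
    -- Lattice vectors dual to `I` modulo two form a square matrix of odd determinant, invertible
    -- over `ℝ`. As they lie in the row space, they annihilate every linear relation among the
    -- columns in `I`.
    choose g hg using fun i : I => h (Pi.single (i : E) 1)
    let G : Matrix I I ℤ := Matrix.of fun i j => (g i : E → ℤ) j
    have hG2 : G.map (Int.castRingHom (ZMod 2)) = 1 := by
      ext i j
      simp [G, hg i j j.2, Pi.single_apply, one_apply, Subtype.ext_iff, eq_comm]
    have hG : G.det ≠ 0 := by
      intro h0
      have h1 := (Int.castRingHom (ZMod 2)).map_det G
      rw [h0, map_zero, RingHom.mapMatrix_apply, hG2, det_one] at h1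
      exact zero_ne_one h1
    have hGR : (G.map (Int.castRingHom ℝ)).det ≠ 0 := by
      have h1 := (Int.castRingHom ℝ).map_det G
      rw [RingHom.mapMatrix_apply] at h1
      rw [← h1]
      simpa using hG
    change LinearIndependent ℝ fun i : I => (A.map (Int.cast : ℤ → ℝ)).col i
    rw [Fintype.linearIndependent_iff]
    intro c hc
    refine congrFun (eq_zero_of_mulVec_eq_zero hGR (v := c) ?_)
    funext i
    obtain ⟨y, hy⟩ := mem_cutLattice_iff_vecMul.1 (g i).2
    have hc' : ∀ k, ∑ j : I, c j * (A k j : ℝ) = 0 := by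
      intro k
      simpa using congrFun hc k
    calc ∑ j : I, (((g i : E → ℤ) j : ℤ) : ℝ) * c j
        = ∑ j : I, ∑ k, y k * (c j * (A k j : ℝ)) := by
          refine Finset.sum_congr rfl fun j _ => ?_
          rw [hy j]
          simp only [vecMul, dotProduct, map_apply, Finset.sum_mul]
          exact Finset.sum_congr rfl fun k _ => by ring
      _ = 0 := by
          rw [Finset.sum_comm]
          simp [← Finset.mul_sum, hc']

end Rounding

/-! ### Characters and the MacWilliams extension theorem -/

section Characters

variable {G : Type*} [AddCommGroup G]

/-- The character `x ↦ (-1) ^ μ x`. -/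
def signCharacter (μ : G →+ ZMod 2) : Multiplicative G →* ℤ where
  toFun x := if μ x.toAdd = 0 then 1 else -1
  map_one' := by simp
  map_mul' x y := by
    have h : ∀ a b : ZMod 2, (if a + b = 0 then 1 else -1 : ℤ) =
        (if a = 0 then 1 else -1) * (if b = 0 then 1 else -1) := by decide
    rw [toAdd_mul, map_add, h]

theorem signCharacter_injective :
    Function.Injective (signCharacter : (G →+ ZMod 2) → Multiplicative G →* ℤ) := by
  intro μ ν h
  ext x
  have h1 : (if μ x = 0 then 1 else -1 : ℤ) = if ν x = 0 then 1 else -1 :=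
    DFunLike.congr_fun h (Multiplicative.ofAdd x)
  have h2 : ∀ a b : ZMod 2, (if a = 0 then 1 else -1 : ℤ) = (if b = 0 then 1 else -1) → a = b := by
    decide
  exact h2 _ _ h1

theorem sum_signCharacter {E : Type*} [Fintype E] (φ : E → G →+ ZMod 2) (x : Multiplicative G) :
    ∑ e, signCharacter (φ e) x = (Fintype.card E : ℤ) -
      2 * (Finset.univ.filter fun e => φ e x.toAdd ≠ 0).card := by
  rw [Finset.card_filter, Nat.cast_sum, Finset.mul_sum, ← Finset.card_univ,
    Finset.card_eq_sum_ones, Nat.cast_sum, ← Finset.sum_sub_distrib]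
  refine Finset.sum_congr rfl fun e _ => ?_
  change (if φ e x.toAdd = 0 then 1 else -1 : ℤ) = _
  split_ifs <;> simp_all

/-- Two families of homomorphisms to `ZMod 2` with the same weight function contain every nonzero
homomorphism equally often. -/
theorem card_fiber_eq_of_weight_eq {E F : Type*} [Fintype E] [Fintype F]
    [DecidableEq (G →+ ZMod 2)] {φ : E → G →+ ZMod 2} {χ : F → G →+ ZMod 2}
    (h : ∀ x, (Finset.univ.filter fun e => φ e x ≠ 0).card =
      (Finset.univ.filter fun f => χ f x ≠ 0).card) {μ : G →+ ZMod 2} (hμ : μ ≠ 0) :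
    (Finset.univ.filter fun e => φ e = μ).card = (Finset.univ.filter fun f => χ f = μ).card := by
  have hli : LinearIndependent ℤ
      fun ν : G →+ ZMod 2 => (signCharacter ν : Multiplicative G → ℤ) :=
    (linearIndependent_monoidHom (Multiplicative G) ℤ).comp _ signCharacter_injective
  -- Equal weights make the two character sums differ by the constant `|E| - |F|`, which the term at
  -- the trivial character cancels. Linear independence of characters then kills every coefficient.
  let c : (G →+ ZMod 2) →₀ ℤ := ∑ e, Finsupp.single (φ e) 1 - ∑ f, Finsupp.single (χ f) 1 +
    Finsupp.single 0 ((Fintype.card F : ℤ) - Fintype.card E)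
  have hc : Finsupp.linearCombination ℤ
      (fun ν : G →+ ZMod 2 => (signCharacter ν : Multiplicative G → ℤ)) c = 0 := by
    funext x
    have h0 : signCharacter (0 : G →+ ZMod 2) x = 1 := by simp [signCharacter]
    simp only [c, map_add, map_sub, map_sum, Finsupp.linearCombination_single, one_smul,
      Pi.add_apply, Pi.sub_apply, Finset.sum_apply, Pi.smul_apply, Pi.zero_apply, h0, sum_signCharacter,
      h x.toAdd, smul_eq_mul]
    ring
  have hc0 := DFunLike.congr_fun ((linearIndependent_iff.1 hli) c hc) μ
  simp only [c, Finsupp.add_apply, Finsupp.sub_apply, Finsupp.finsetSum_apply,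
    Finsupp.single_apply, if_neg hμ.symm, Finsupp.zero_apply, ← Nat.cast_one (R := ℤ),
    ← Nat.cast_zero (R := ℤ), ← apply_ite (Nat.cast : ℕ → ℤ), ← Nat.cast_sum,
    ← Finset.card_filter] at hc0
  omega

theorem exists_equiv_of_card_fiber_eq {E F P : Type*} [Fintype E] [Fintype F] [DecidableEq P]
    (p : E → P) (q : F → P) (h : ∀ μ, Fintype.card {e // p e = μ} = Fintype.card {f // q f = μ}) :
    ∃ π : E ≃ F, ∀ e, q (π e) = p e := by
  let π : E ≃ F := (Equiv.sigmaFiberEquiv p).symm.trans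
    ((Equiv.sigmaCongrRight fun μ => Fintype.equivOfCardEq (h μ)).trans (Equiv.sigmaFiberEquiv q))
  exact ⟨π, fun e => (Fintype.equivOfCardEq (h (p e)) ⟨e, rfl⟩).2⟩

/-- The extension theorem of MacWilliams for binary codes: a weight preserving isomorphism is given
by a bijection of the nonzero coordinates. -/
theorem exists_equiv_of_weight_eq {E F : Type*} [Fintype E] [Fintype F]
    {φ : E → G →+ ZMod 2} {χ : F → G →+ ZMod 2}
    (h : ∀ x, (Finset.univ.filter fun e => φ e x ≠ 0).card =
      (Finset.univ.filter fun f => χ f x ≠ 0).card) :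
    ∃ π : {e // φ e ≠ 0} ≃ {f // χ f ≠ 0}, ∀ e, χ (π e) = φ e := by
  classical
  refine exists_equiv_of_card_fiber_eq (fun e : {e // φ e ≠ 0} => φ e)
    (fun f : {f // χ f ≠ 0} => χ f) fun μ => ?_
  by_cases hμ : μ = 0
  · subst hμ
    rw [Fintype.card_eq_zero_iff.2 ⟨fun e => e.1.2 e.2⟩,
      Fintype.card_eq_zero_iff.2 ⟨fun f => f.1.2 f.2⟩]
  · rw [Fintype.card_congr (Equiv.subtypeSubtypeEquivSubtype (p := fun e => φ e ≠ 0)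
        (q := fun e => φ e = μ) fun h => h ▸ hμ),
      Fintype.card_congr (Equiv.subtypeSubtypeEquivSubtype (p := fun f => χ f ≠ 0)
        (q := fun f => χ f = μ) fun h => h ▸ hμ), Fintype.card_subtype, Fintype.card_subtype]
    exact card_fiber_eq_of_weight_eq h hμ

end Characters

/-! ### Isometries preserve weights modulo two -/

section Weight

variable {E F : Type*} [Fintype E] [Fintype F] {r s : ℕ} {A : Matrix (Fin r) E ℤ}
  {B : Matrix (Fin s) F ℤ}

/-- A shortest vector of `x + 2Γ` has norm equal to the odd count of `x`. Its image is congruent to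
`ψ x` modulo two and has the same norm, which bounds the odd count of `ψ x`. -/
theorem card_odd_le_of_isometry (hA : A.IsTotallyUnimodular)
    (hr : (A.map (Int.cast : ℤ → ℝ)).rank = r) (ψ : cutLattice A ≃+ cutLattice B)
    (hψ : ∀ x, ((ψ x : cutLattice B) : F → ℤ) ⬝ᵥ ((ψ x : cutLattice B) : F → ℤ) =
      (x : E → ℤ) ⬝ᵥ (x : E → ℤ)) (x : cutLattice A) :
    (Finset.univ.filter fun f => ((ψ x : F → ℤ) f : ZMod 2) ≠ 0).card ≤
      (Finset.univ.filter fun e => ((x : E → ℤ) e : ZMod 2) ≠ 0).card := by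
  obtain ⟨g, hg⟩ := exists_card_odd_eq_dotProduct_self hA hr x
  have h1 : ∀ f, ((ψ x : F → ℤ) f : ZMod 2) = ((ψ (x - (g + g)) : F → ℤ) f : ZMod 2) := by
    intro f
    have : (ψ (x - (g + g)) : F → ℤ) f = (ψ x : F → ℤ) f - ((ψ g : F → ℤ) f + (ψ g : F → ℤ) f) := by
      rw [map_sub, map_add]
      rfl
    rw [this]
    push_cast
    rw [CharTwo.add_self_eq_zero, sub_zero]
  simp only [h1]
  have h2 := card_odd_le_dotProduct_self (ψ (x - (g + g)) : F → ℤ)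
  rw [hψ, ← hg] at h2
  exact_mod_cast h2

/-- The coordinate `e` of the cut lattice modulo two. -/
def coordModTwo (A : Matrix (Fin r) E ℤ) (e : E) : cutLattice A →+ ZMod 2 where
  toFun x := ((x : E → ℤ) e : ZMod 2)
  map_zero' := by simp
  map_add' x y := by simp

theorem exists_equiv_of_isometric (hA : A.IsTotallyUnimodular)
    (hr : (A.map (Int.cast : ℤ → ℝ)).rank = r) (hB : B.IsTotallyUnimodular)
    (hs : (B.map (Int.cast : ℤ → ℝ)).rank = s) (h : Isometric (cutLattice A) (cutLattice B)) :
    ∃ (ψ : cutLattice A ≃+ cutLattice B)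
      (π : {e // coordModTwo A e ≠ 0} ≃ {f // coordModTwo B f ≠ 0}),
      ∀ e x, coordModTwo B (π e) (ψ x) = coordModTwo A e x := by
  obtain ⟨ψ, hψ⟩ := h
  obtain ⟨π, hπ⟩ := exists_equiv_of_weight_eq (φ := coordModTwo A)
    (χ := fun f => (coordModTwo B f).comp (ψ : cutLattice A →+ cutLattice B)) fun x => by
      refine le_antisymm ?_ (card_odd_le_of_isometry hA hr ψ (fun x => hψ x x) x)
      have h1 := card_odd_le_of_isometry hB hs ψ.symm
        (fun y => by rw [← hψ, ψ.apply_symm_apply]) (ψ x)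
      rw [ψ.symm_apply_apply] at h1
      exact h1
  have hχ : ∀ f, (coordModTwo B f).comp (ψ : cutLattice A →+ cutLattice B) ≠ 0 ↔
      coordModTwo B f ≠ 0 := by
    intro f
    refine not_congr ⟨fun h => ?_, fun h => by rw [h, AddMonoidHom.zero_comp]⟩
    ext y
    simpa using DFunLike.congr_fun h (ψ.symm y)
  exact ⟨ψ, π.trans (Equiv.subtypeEquivRight hχ), fun e x => DFunLike.congr_fun (hπ e) x⟩

end Weight

/-! ### From equal column matroids to an isometry -/

section Signed

variable {X E F : Type*} {r s : ℕ} {A : Matrix (Fin r) E ℤ}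
  {B : Matrix (Fin s) F ℤ}

theorem apply_eq_zero_of_col_eq_zero {x : E → ℤ} (hx : x ∈ cutLattice A) {e : E}
    (he : (A.map (Int.cast : ℤ → ℝ)).col e = 0) : x e = 0 := by
  obtain ⟨y, hy⟩ := mem_cutLattice_iff_vecMul.1 hx
  have h : (x e : ℝ) = 0 := by
    rw [hy e]
    change y ⬝ᵥ (A.map (Int.cast : ℤ → ℝ)).col e = 0
    rw [he, dotProduct_zero]
  exact_mod_cast h

/-- By Cramer's rule the entry is the determinant of the identity with column `i` replaced by column
`e` of the standard form. Thus the support depends only on which column families are bases. -/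
theorem standardForm_ne_zero_iff (hA : A.IsTotallyUnimodular) {b : Fin r → E}
    (hb : IsColumnBasis A b) (i : Fin r) (e : E) :
    standardForm A b i e ≠ 0 ↔ IsColumnBasis A (Function.update b i e) := by
  have h1 : (standardForm A b).submatrix id (Function.update b i e) =
      (1 : Matrix (Fin r) (Fin r) ℤ).updateCol i ((standardForm A b).col e) := by
    rw [← standardForm_submatrix hA hb]
    ext k j
    by_cases hj : j = i
    · subst hj
      simp
    · simp [hj]
  rw [isColumnBasis_iff_det_ne_zero, ← det_standardForm_submatrix hA hb, h1, ← cramer_apply,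
    cramer_one]
  simp [isColumnBasis_iff_det_ne_zero.1 hb]

theorem exists_isColumnBasis_comp [Fintype E] (hr : (A.map (Int.cast : ℤ → ℝ)).rank = r) {a : X → E}
    (ha : ∀ e, e ∉ Set.range a → (A.map (Int.cast : ℤ → ℝ)).col e = 0) :
    ∃ c : Fin r → X, IsColumnBasis A (a ∘ c) := by
  obtain ⟨b, hb⟩ := exists_isColumnBasis hr
  have h : ∀ i, ∃ x, a x = b i := by
    intro i
    by_contra hi
    exact hb.ne_zero i (ha _ hi)
  choose c hc using h
  exact ⟨c, by rwa [show a ∘ c = b from funext hc]⟩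

theorem rank_le_of_linearIndepOn_imp [Fintype E] (hr : (A.map (Int.cast : ℤ → ℝ)).rank = r) {a : X → E}
    {a' : X → F} (ha' : a'.Injective)
    (ha0 : ∀ e, e ∉ Set.range a → (A.map (Int.cast : ℤ → ℝ)).col e = 0)
    (h : ∀ I : Set X, LinearIndepOn ℝ (A.map (Int.cast : ℤ → ℝ)).col (a '' I) →
      LinearIndepOn ℝ (B.map (Int.cast : ℤ → ℝ)).col (a' '' I)) : r ≤ s := by
  obtain ⟨c, hc⟩ := exists_isColumnBasis_comp hr ha0
  obtain ⟨hinj, hc⟩ := isColumnBasis_iff_linearIndepOn.1 hc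
  rw [Set.range_comp] at hc
  have h1 := h _ hc
  rw [← Set.range_comp, linearIndepOn_range_iff (ha'.comp (hinj.of_comp))] at h1
  simpa using h1.fintype_card_le_finrank

/-- Totally unimodular matrices with the same column matroid, up to zero columns, have isometric
cut lattices. -/
theorem isometric_of_linearIndepOn_iff [Fintype E] [Fintype F] (hA : A.IsTotallyUnimodular)
    (hr : (A.map (Int.cast : ℤ → ℝ)).rank = r) (hB : B.IsTotallyUnimodular)
    (hs : (B.map (Int.cast : ℤ → ℝ)).rank = s) {a : X → E} {a' : X → F}
    (ha : a.Injective) (ha' : a'.Injective)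
    (ha0 : ∀ e, e ∉ Set.range a → (A.map (Int.cast : ℤ → ℝ)).col e = 0)
    (ha0' : ∀ f, f ∉ Set.range a' → (B.map (Int.cast : ℤ → ℝ)).col f = 0)
    (h : ∀ I : Set X, LinearIndepOn ℝ (A.map (Int.cast : ℤ → ℝ)).col (a '' I) ↔
      LinearIndepOn ℝ (B.map (Int.cast : ℤ → ℝ)).col (a' '' I)) :
    Isometric (cutLattice A) (cutLattice B) := by
  obtain rfl : r = s := le_antisymm
    (rank_le_of_linearIndepOn_imp hr ha' ha0 fun I => (h I).1)
    (rank_le_of_linearIndepOn_imp hs ha ha0' fun I => (h I).2)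
  have hbasis : ∀ c : Fin r → X, IsColumnBasis A (a ∘ c) ↔ IsColumnBasis B (a' ∘ c) := by
    intro c
    rw [isColumnBasis_iff_linearIndepOn, isColumnBasis_iff_linearIndepOn, Set.range_comp,
      Set.range_comp, h, ha.of_comp_iff, ha'.of_comp_iff]
  obtain ⟨c, hb⟩ := exists_isColumnBasis_comp hr ha0
  have hb' := (hbasis c).1 hb
  have : Finite X := Finite.of_injective a ha
  cases nonempty_fintype X
  obtain ⟨ρ, σ, hσ⟩ := exists_signing
    ((isTotallyUnimodular_standardForm hA hb).submatrix id a)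
    ((isTotallyUnimodular_standardForm hB hb').submatrix id a') (by
      intro i x
      apply not_iff_not.1
      change standardForm A (a ∘ c) i (a x) ≠ 0 ↔ standardForm B (a' ∘ c) i (a' x) ≠ 0
      rw [standardForm_ne_zero_iff hA hb, standardForm_ne_zero_iff hB hb', ← Function.comp_update,
        ← Function.comp_update, hbasis])
  have hρ : ∀ i, (ρ i : ℤ) * ρ i = 1 := fun i => by
    rw [← Units.val_mul, Int.units_mul_self, Units.val_one]
  have hσσ : ∀ i, (σ i : ℤ) * σ i = 1 := fun i => by
    rw [← Units.val_mul, Int.units_mul_self, Units.val_one]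
  let scale : (Fin r → ℤ) ≃+ (Fin r → ℤ) :=
    { toFun := fun y i => ρ i * y i
      invFun := fun y i => ρ i * y i
      left_inv := fun y => funext fun i => by beta_reduce; rw [← mul_assoc, hρ, one_mul]
      right_inv := fun y => funext fun i => by beta_reduce; rw [← mul_assoc, hρ, one_mul]
      map_add' := fun y z => funext fun i => mul_add _ _ _ }
  -- Transport the coordinates on the basis, corrected by the row signs; what remains on each
  -- coordinate is the column sign, which squares to one.
  let ψ : cutLattice A ≃+ cutLattice B :=
    ((cutLatticeEquiv hA hb).trans scale).trans (cutLatticeEquiv hB hb').symm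
  have hψ : ∀ (x : cutLattice A) (p : X), (ψ x : F → ℤ) (a' p) = σ p * (x : E → ℤ) (a p) := by
    intro x p
    conv_rhs => rw [← eq_vecMul_standardForm hA hb x.2]
    change ∑ i, (ρ i * (x : E → ℤ) (a (c i))) * standardForm B (a' ∘ c) i (a' p) =
      σ p * ∑ i, (x : E → ℤ) (a (c i)) * standardForm A (a ∘ c) i (a p)
    rw [Finset.mul_sum]
    refine Finset.sum_congr rfl fun i _ => ?_
    have h1 : standardForm B (a' ∘ c) i (a' p) = ρ i * σ p * standardForm A (a ∘ c) i (a p) :=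
      hσ i p
    rw [h1]
    linear_combination (x : E → ℤ) (a (c i)) * σ p * standardForm A (a ∘ c) i (a p) * hρ i
  refine ⟨ψ, fun x y => ?_⟩
  rw [dotProduct, dotProduct]
  rw [← Fintype.sum_of_injective a' ha' (fun p => (x : E → ℤ) (a p) * (y : E → ℤ) (a p)),
    ← Fintype.sum_of_injective a ha (fun p => (x : E → ℤ) (a p) * (y : E → ℤ) (a p))]
  · intro e he
    rw [apply_eq_zero_of_col_eq_zero x.2 (ha0 e he), zero_mul]
  · exact fun p => rfl
  · intro f hf
    rw [apply_eq_zero_of_col_eq_zero (ψ x).2 (ha0' f hf), zero_mul]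
  · intro p
    rw [hψ, hψ]
    linear_combination -(x : E → ℤ) (a p) * (y : E → ℤ) (a p) * hσσ p

end Signed

/-! ### Loops as zero coordinates -/

section Loops

variable {α : Type*} {M : Matroid α}

/-- The inclusion of the ground set of `M°` into that of `M`. -/
def deleteLoopsInclusion (M : Matroid α) : (deleteLoops M).E → M.E :=
  fun e => ⟨e, e.2.1⟩

theorem deleteLoopsInclusion_injective : (deleteLoopsInclusion M).Injective :=
  fun _ _ h => Subtype.ext (congrArg (Subtype.val : M.E → α) h)

variable [Fintype M.E] {r : ℕ} {A : Matrix (Fin r) M.E ℤ}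

theorem IsTURepresentation.mem_range_iff (h : IsTURepresentation M A) (e : M.E) :
    e ∈ Set.range (deleteLoopsInclusion M) ↔
      LinearIndepOn ℝ (A.map (Int.cast : ℤ → ℝ)).col {e} := by
  rw [← h.indep_iff, Set.image_singleton, Matroid.indep_singleton,
    ← Matroid.not_isLoop_iff e.2]
  constructor
  · rintro ⟨x, rfl⟩ hx
    exact x.2.2 hx
  · intro he
    exact ⟨⟨e, e.2, he⟩, rfl⟩

theorem IsTURepresentation.col_eq_zero (h : IsTURepresentation M A) (e : M.E)
    (he : e ∉ Set.range (deleteLoopsInclusion M)) : (A.map (Int.cast : ℤ → ℝ)).col e = 0 := by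
  rw [h.mem_range_iff, linearIndepOn_singleton_iff, not_not] at he
  exact he

theorem IsTURepresentation.indep_deleteLoops_iff (h : IsTURepresentation M A)
    (I : Set (deleteLoops M).E) :
    (deleteLoops M).Indep (Subtype.val '' I) ↔
      LinearIndepOn ℝ (A.map (Int.cast : ℤ → ℝ)).col (deleteLoopsInclusion M '' I) := by
  rw [← h.indep_iff, Set.image_image]
  refine Matroid.delete_indep_iff.trans ?_
  rw [and_iff_left]
  · rfl
  · rw [Set.disjoint_left]
    rintro _ ⟨x, -, rfl⟩
    exact x.2.2

theorem IsTURepresentation.indep_deleteLoops_iff_coordModTwo (h : IsTURepresentation M A)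
    (I : Set (deleteLoops M).E) :
    (deleteLoops M).Indep (Subtype.val '' I) ↔ ∀ t : (deleteLoops M).E → ZMod 2,
      ∃ g, ∀ i ∈ I, coordModTwo A (deleteLoopsInclusion M i) g = t i := by
  rw [h.indep_deleteLoops_iff, linearIndepOn_col_iff h.totallyUnimodular h.rank_eq]
  constructor
  · intro ht t
    obtain ⟨g, hg⟩ := ht (Function.extend (deleteLoopsInclusion M) t 0)
    refine ⟨g, fun i hi => ?_⟩
    rw [← deleteLoopsInclusion_injective.extend_apply t 0 i]
    exact hg _ ⟨i, hi, rfl⟩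
  · intro ht t
    obtain ⟨g, hg⟩ := ht fun i => t (deleteLoopsInclusion M i)
    refine ⟨g, ?_⟩
    rintro _ ⟨i, hi, rfl⟩
    exact hg i hi

/-- The criterion modulo two for a singleton asks that the coordinate map be onto `ZMod 2`, which
holds as soon as it is nonzero. -/
theorem IsTURepresentation.mem_range_iff_coordModTwo (h : IsTURepresentation M A) (e : M.E) :
    e ∈ Set.range (deleteLoopsInclusion M) ↔ coordModTwo A e ≠ 0 := by
  rw [h.mem_range_iff, linearIndepOn_col_iff h.totallyUnimodular h.rank_eq]
  constructor
  · intro ht h0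
    obtain ⟨g, hg⟩ := ht 1
    have h1 : coordModTwo A e g = 1 := hg e rfl
    rw [h0] at h1
    exact zero_ne_one h1
  · intro h0 t
    obtain ⟨g, hg⟩ := DFunLike.ne_iff.1 h0
    have hz : ∀ z w : ZMod 2, z ≠ 0 → w = 0 ∨ w = z := by decide
    rcases hz _ (t e) hg with h1 | h1
    · exact ⟨0, by rintro i rfl; simp [h1]⟩
    · exact ⟨g, by rintro i rfl; exact h1.symm⟩

/-- The elements of `M°` are the nonzero coordinates modulo two. -/
noncomputable def IsTURepresentation.deleteLoopsEquiv (h : IsTURepresentation M A) :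
    (deleteLoops M).E ≃ {e // coordModTwo A e ≠ 0} :=
  (Equiv.ofInjective _ deleteLoopsInclusion_injective).trans
    (Equiv.subtypeEquivRight h.mem_range_iff_coordModTwo)

end Loops

end RegularMatroid

/-! ### The main theorem -/

theorem mainTheorem8 {α : Type*} {β : Type*} (M : Matroid α) (N : Matroid β)
    [Fintype M.E] [Fintype N.E]
    (hM : RegularMatroid.IsRegular M) (hN : RegularMatroid.IsRegular N) :
    ∀ {r s : ℕ} (A : Matrix (Fin r) M.E ℤ) (B : Matrix (Fin s) N.E ℤ),
      RegularMatroid.IsTURepresentation M A → RegularMatroid.IsTURepresentation N B →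
      (RegularMatroid.Isometric (RegularMatroid.cutLattice A) (RegularMatroid.cutLattice B) ↔
        RegularMatroid.Isomorphic (RegularMatroid.deleteLoops M)
          (RegularMatroid.deleteLoops N)) := by
  intro r s A B hA hB
  constructor
  · intro h
    obtain ⟨ψ, π, hπ⟩ := RegularMatroid.exists_equiv_of_isometric hA.totallyUnimodular hA.rank_eq
      hB.totallyUnimodular hB.rank_eq h
    let e := (hA.deleteLoopsEquiv.trans π).trans hB.deleteLoopsEquiv.symm
    have he : ∀ i x, RegularMatroid.coordModTwo B (RegularMatroid.deleteLoopsInclusion N (e i))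
        (ψ x) = RegularMatroid.coordModTwo A (RegularMatroid.deleteLoopsInclusion M i) x := by
      intro i x
      have h1 : hB.deleteLoopsEquiv (e i) = π (hA.deleteLoopsEquiv i) :=
        hB.deleteLoopsEquiv.apply_symm_apply _
      have h2 : RegularMatroid.deleteLoopsInclusion N (e i) = π (hA.deleteLoopsEquiv i) :=
        congrArg Subtype.val h1
      rw [h2, hπ]
      rfl
    refine ⟨e, fun I => ?_⟩
    -- Both sides now ask for arbitrary values modulo two on a set of coordinates; `ψ` and `e` carry
    -- solutions across.
    rw [hA.indep_deleteLoops_iff_coordModTwo, hB.indep_deleteLoops_iff_coordModTwo]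
    constructor
    · intro ht t
      obtain ⟨g, hg⟩ := ht fun i => t (e i)
      refine ⟨ψ g, ?_⟩
      rintro _ ⟨i, hi, rfl⟩
      rw [he, hg i hi]
    · intro ht t
      obtain ⟨g, hg⟩ := ht fun j => t (e.symm j)
      refine ⟨ψ.symm g, fun i hi => ?_⟩
      rw [← he, ψ.apply_symm_apply, hg _ ⟨i, hi, rfl⟩, e.symm_apply_apply]
  · rintro ⟨e, he⟩
    -- The ground set of `M°` indexes the nonzero columns of both matrices, directly for `A` and
    -- through `e` for `B`.
    refine RegularMatroid.isometric_of_linearIndepOn_iff hA.totallyUnimodular hA.rank_eq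
      hB.totallyUnimodular hB.rank_eq RegularMatroid.deleteLoopsInclusion_injective
      (RegularMatroid.deleteLoopsInclusion_injective.comp e.injective) hA.col_eq_zero ?_ ?_
    · intro f hf
      apply hB.col_eq_zero
      rwa [e.surjective.range_comp] at hf
    · intro I
      rw [Set.image_comp, ← hA.indep_deleteLoops_iff, ← hB.indep_deleteLoops_iff, he]
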